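/- Let $\Omega\subset\mathbb R^d$ be a bounded open set, and let $\hat H=-\tfrac12\Delta+V$, with $V$ real-valued and with boundary conditions that make $\hat H$ symmetric on its domain $D(\hat H)\subset L^2(\Omega)$ (complex-valued functions, $\langle u,v\rangle=\int_\Omega u^*v\,dx$). Assume that $\hat H$ has a complete orthonormal system of eigenfunctions $\phi_1,\phi_2,\ldots\in D(\hat H)$ with eigenvalues $\lambda_1\le\lambda_2\le\cdots$. Let $N\ge1$ be such that $\lambda_N<\lambda_{N+1}$, and let $J:L^2(\Omega)\to\mathbb R$ satisfy $0\le J(g)\le C\|g\|_2$ for all $g\in L^2(\Omega)$, with a constant $C$. For $\mu>0$, consider the problem of minimizing $$\sum_{i=1}^N\Big(\frac1\mu J(\tilde f_i)+\langle\tilde f_i,\hat H\tilde f_i\rangle\Big)$$ over all $\tilde f_1,\ldots,\tilde f_N\in D(\hat H)$ with $\langle\tilde f_j,\tilde f_k\rangle=\delta_{jk}$. For a solution $(f_1,\ldots,f_N)$ of this problem, let $\nu_1\le\cdots\le\nu_N$ be the eigenvalues of the Hermitian $N\times N$ matrix with entries $\langle f_j,\hat Hf_k\rangle$. Then $(\nu_1,\ldots,\nu_N)$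 converges to $(\lambda_1,\ldots,\lambda_N)$ as $\mu\to\infty$: for every $\varepsilon>0$ there is $\mu_0>0$ such that for all $\mu>\mu_0$, every solution $(f_1,\ldots,f_N)$ of the problem with parameter $\mu$ satisfies $|\nu_i-\lambda_i|<\varepsilon$ for $i=1,\ldots,N$. In particular, this holds for $J(g)=\int_\Omega|g|\,dx$, that is, for the compressed modes. -/

import Mathlib

open MeasureTheory Filter
open scoped ContDiff

noncomputable section

namespace CompressedModes

/-- The complex Hilbert space `L²(Ω)`, for `Ω ⊆ ℝᵈ` with Lebesgue measure. -/
abbrev L2 {d : ℕ} (Ω : Set (EuclideanSpace ℝ (Fin d))) : Type :=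
  Lp ℂ 2 ((volume : Measure (EuclideanSpace ℝ (Fin d))).restrict Ω)

/-- `w = -½ Δ u + V u` on `Ω` in the sense of distributions (`V u` being locally integrable). -/
def IsWeakSchrodinger {d : ℕ} (Ω : Set (EuclideanSpace ℝ (Fin d)))
    (V : EuclideanSpace ℝ (Fin d) → ℝ) (u w : L2 Ω) : Prop :=
  LocallyIntegrableOn (fun x => (V x : ℂ) * u x) Ω volume ∧
  ∀ η : EuclideanSpace ℝ (Fin d) → ℝ, ContDiff ℝ ∞ η → HasCompactSupport η → tsupport η ⊆ Ω →
    ∫ x in Ω, (η x : ℂ) * w x =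
      ∫ x in Ω, (((-(1 / 2) * Laplacian.laplacian η x : ℝ) : ℂ) * u x
        + (η x : ℂ) * ((V x : ℂ) * u x))

/-- `H` is a Hamiltonian `-½ Δ + V` in `L²(Ω)`: a symmetric operator that acts on its domain as
the differential expression `-½ Δ + V`. The boundary conditions (Dirichlet, Neumann, periodic, …)
are those encoded in the domain of `H`. -/
structure IsHamiltonian {d : ℕ} (Ω : Set (EuclideanSpace ℝ (Fin d)))
    (V : EuclideanSpace ℝ (Fin d) → ℝ) (H : L2 Ω →ₗ.[ℂ] L2 Ω) : Prop where
  symmetric : H.IsFormalAdjoint H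
  acts : ∀ u : H.domain, IsWeakSchrodinger Ω V (u : L2 Ω) (H u)

/-- `φ 0, φ 1, …` is a complete orthonormal system of eigenfunctions of `H`, with corresponding
eigenvalues `lam 0 ≤ lam 1 ≤ …` (so that each eigenvalue is listed with its multiplicity). -/
structure IsOrderedEigenbasis {d : ℕ} {Ω : Set (EuclideanSpace ℝ (Fin d))}
    (H : L2 Ω →ₗ.[ℂ] L2 Ω) (φ : ℕ → H.domain) (lam : ℕ → ℝ) : Prop where
  orthonormal : Orthonormal ℂ (fun k => (φ k : L2 Ω))
  complete : (Submodule.span ℂ (Set.range fun k => (φ k : L2 Ω))).topologicalClosure = ⊤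
  eigen : ∀ k, H (φ k) = (lam k : ℂ) • (φ k : L2 Ω)
  mono : Monotone lam

/-- The regularized energy `∑ᵢ (1/μ) J(fᵢ) + ⟨fᵢ, H fᵢ⟩` (the inner products are real, `H` being
symmetric). -/
def regEnergy {d : ℕ} {Ω : Set (EuclideanSpace ℝ (Fin d))} (H : L2 Ω →ₗ.[ℂ] L2 Ω)
    (J : L2 Ω → ℝ) (μ : ℝ) {N : ℕ} (f : Fin N → H.domain) : ℝ :=
  ∑ i, (1 / μ * J (f i : L2 Ω) + (inner ℂ (f i : L2 Ω) (H (f i))).re)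

/-- `f₁, …, f_N` minimize the regularized energy among all orthonormal `N`-tuples. -/
structure IsRegMinimizer {d : ℕ} {Ω : Set (EuclideanSpace ℝ (Fin d))} (H : L2 Ω →ₗ.[ℂ] L2 Ω)
    (J : L2 Ω → ℝ) (μ : ℝ) {N : ℕ} (f : Fin N → H.domain) : Prop where
  orthonormal : Orthonormal ℂ (fun i => (f i : L2 Ω))
  le : ∀ g : Fin N → H.domain, Orthonormal ℂ (fun i => (g i : L2 Ω)) →
    regEnergy H J μ f ≤ regEnergy H J μ g

/-- The `N × N` matrix with entries `⟨f_j, H f_k⟩`. -/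
def energyMatrix {d : ℕ} {Ω : Set (EuclideanSpace ℝ (Fin d))} (H : L2 Ω →ₗ.[ℂ] L2 Ω)
    {N : ℕ} (f : Fin N → H.domain) : Matrix (Fin N) (Fin N) ℂ :=
  Matrix.of fun j k => inner ℂ (f j : L2 Ω) (H (f k))

theorem energyMatrix_isHermitian {d : ℕ} {Ω : Set (EuclideanSpace ℝ (Fin d))}
    {H : L2 Ω →ₗ.[ℂ] L2 Ω} (hH : H.IsFormalAdjoint H) {N : ℕ} (f : Fin N → H.domain) :
    (energyMatrix H f).IsHermitian := by
  ext j k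
  simp only [energyMatrix, Matrix.conjTranspose_apply, Matrix.of_apply, RCLike.star_def,
    inner_conj_symm]
  exact hH (f j) (f k)

/-- The eigenvalues of a Hermitian `N × N` matrix, with multiplicity, in non-decreasing order
(Mathlib's `eigenvalues₀` lists them in non-increasing order). -/
def orderedEigenvalues {N : ℕ} {M : Matrix (Fin N) (Fin N) ℂ} (hM : M.IsHermitian) :
    Fin N → ℝ :=
  fun i => hM.eigenvalues₀ (Fin.cast (Fintype.card_fin N).symm (Fin.rev i))

/-- `J` is a nonnegative bounded functional on `L²(Ω)`: `0 ≤ J g ≤ C ‖g‖₂`. -/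
def IsNonnegBounded {d : ℕ} {Ω : Set (EuclideanSpace ℝ (Fin d))} (J : L2 Ω → ℝ) : Prop :=
  ∃ C : ℝ, ∀ g : L2 Ω, 0 ≤ J g ∧ J g ≤ C * ‖g‖

/-- The `L¹` norm `∫_Ω |g|`. -/
def l1Norm {d : ℕ} {Ω : Set (EuclideanSpace ℝ (Fin d))} (g : L2 Ω) : ℝ :=
  ∫ x in Ω, ‖g x‖

end CompressedModes

end

namespace CompressedModes

open scoped InnerProductSpace

section Abstract

variable {E : Type*} [NormedAddCommGroup E] [InnerProductSpace ℂ E]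

/-! Only the sum of the Ritz values has to be controlled. By a Courant–Fischer argument
(`le_orderedEigenvalues_energyMatrix`), `ν i ≥ lam i` for every orthonormal family in the domain.
Testing minimality against the first `N` eigenfunctions, and discarding `J ≥ 0` on the minimizer,
gives `∑ ν i ≤ ∑ lam i + N * C / μ`. The differences `ν i - lam i` are nonnegative with sum at most
`N * C / μ`, so each obeys this bound (`orderedEigenvalues_sub_le`). No convergence of the
minimizers themselves is needed. -/

/-- A symmetric operator with an ordered Hilbert basis of eigenvectors is bounded below by
`lam n` on the vectors of its domain that are orthogonal to the first `n` basis vectors. -/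
theorem mul_sq_norm_le_re_inner_apply (b : HilbertBasis ℕ ℂ E) {H : E →ₗ.[ℂ] E}
    (hH : H.IsFormalAdjoint H) {φ : ℕ → H.domain} (hb : ∀ k, b k = φ k) {lam : ℕ → ℝ}
    (heig : ∀ k, H (φ k) = (lam k : ℂ) • (φ k : E)) (hmono : Monotone lam) {n : ℕ}
    (u : H.domain) (hu : ∀ k < n, ⟪(φ k : E), (u : E)⟫_ℂ = 0) :
    lam n * ‖(u : E)‖ ^ 2 ≤ (⟪(u : E), H u⟫_ℂ).re := by
  -- Symmetry moves `H` onto the eigenvector; `H` may be unbounded, so it is not applied termwise to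
  -- the expansion of `u`.
  have hcoef : ∀ k, ⟪b k, H u⟫_ℂ = lam k * ⟪b k, (u : E)⟫_ℂ := fun k => by
    rw [hb, ← hH (φ k) u, heig, inner_smul_left, Complex.conj_ofReal]
  have hsq : ∀ k, ⟪(u : E), b k⟫_ℂ * ⟪b k, (u : E)⟫_ℂ =
      ((‖⟪b k, (u : E)⟫_ℂ‖ ^ 2 : ℝ) : ℂ) := fun k => by
    rw [← inner_conj_symm, RCLike.conj_mul]
    norm_cast
  have hnorm := (Complex.hasSum_re (b.hasSum_inner_mul_inner (u : E) u)).mul_left (lam n)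
  have henergy := Complex.hasSum_re (b.hasSum_inner_mul_inner (u : E) (H u))
  have hself : (⟪(u : E), (u : E)⟫_ℂ).re = ‖(u : E)‖ ^ 2 := inner_self_eq_norm_sq (𝕜 := ℂ) _
  rw [← hself]
  refine hasSum_le (fun k => ?_) hnorm henergy
  rw [hcoef, mul_left_comm, hsq, ← Complex.ofReal_mul, Complex.ofReal_re, Complex.ofReal_re]
  rcases lt_or_ge k n with hk | hk
  · rw [hb, hu k hk]
    simp
  · exact mul_le_mul_of_nonneg_right (hmono hk) (by positivity)

end Abstract

section Eigenvalues

variable {N : ℕ} {M : Matrix (Fin N) (Fin N) ℂ}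

/-- The permutation which turns Mathlib's indexing of the eigenvalues into the non-decreasing
one. -/
noncomputable def eigenvalueOrder (N : ℕ) : Fin N ≃ Fin N :=
  (Fin.revPerm.trans (finCongr (Fintype.card_fin N).symm)).trans
    -- The inverse of this equivalence occurs in `Matrix.IsHermitian.eigenvalues`, so the two
    -- cancel.
    (Fintype.equivOfCardEq (Fintype.card_fin _))

theorem eigenvalues_eigenvalueOrder (hM : M.IsHermitian) (i : Fin N) :
    hM.eigenvalues (eigenvalueOrder N i) = orderedEigenvalues hM i := by
  simp [Matrix.IsHermitian.eigenvalues, eigenvalueOrder, orderedEigenvalues]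

theorem orderedEigenvalues_monotone (hM : M.IsHermitian) : Monotone (orderedEigenvalues hM) :=
  fun _ _ h => hM.eigenvalues₀_antitone (by simpa [Fin.le_def] using Fin.rev_le_rev.mpr h)

/-- The energy contains only diagonal matrix entries; the trace turns them into eigenvalues. -/
theorem sum_orderedEigenvalues (hM : M.IsHermitian) :
    ∑ i, orderedEigenvalues hM i = M.trace.re := by
  simp_rw [hM.trace_eq_sum_eigenvalues, ← eigenvalues_eigenvalueOrder]
  rw [Equiv.sum_comp (eigenvalueOrder N) hM.eigenvalues]
  simp

/-- The orthonormal basis of eigenvectors belonging to `orderedEigenvalues`. -/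
noncomputable def orderedEigenvectors (hM : M.IsHermitian) :
    OrthonormalBasis (Fin N) ℂ (EuclideanSpace ℂ (Fin N)) :=
  hM.eigenvectorBasis.reindex (eigenvalueOrder N).symm

theorem toEuclideanLin_orderedEigenvectors (hM : M.IsHermitian) (i : Fin N) :
    Matrix.toEuclideanLin M (orderedEigenvectors hM i) =
      (orderedEigenvalues hM i : ℂ) • orderedEigenvectors hM i := by
  ext j
  have := congrFun (hM.mulVec_eigenvectorBasis (eigenvalueOrder N i)) j
  simpa [orderedEigenvectors, eigenvalues_eigenvalueOrder, Matrix.toLpLin_apply] using this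

/-- On the span of the first `i + 1` eigenvectors, the quadratic form is at most the `i`-th
eigenvalue. -/
theorem re_inner_toEuclideanLin_le (hM : M.IsHermitian) {i : Fin N}
    {x : EuclideanSpace ℂ (Fin N)} (hx : ∀ k, i < k → ⟪orderedEigenvectors hM k, x⟫_ℂ = 0) :
    (⟪x, Matrix.toEuclideanLin M x⟫_ℂ).re ≤ orderedEigenvalues hM i * ‖x‖ ^ 2 := by
  set v := orderedEigenvectors hM
  have hsymm : (Matrix.toEuclideanLin M).IsSymmetric :=
    Matrix.isSymmetric_toEuclideanLin_iff.mpr hM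
  rw [← v.sum_inner_mul_inner, ← v.sum_sq_norm_inner_right x, Finset.mul_sum, Complex.re_sum]
  refine Finset.sum_le_sum fun k _ => ?_
  have hterm : ⟪x, v k⟫_ℂ * ⟪v k, Matrix.toEuclideanLin M x⟫_ℂ =
      ((orderedEigenvalues hM k * ‖⟪v k, x⟫_ℂ‖ ^ 2 : ℝ) : ℂ) := by
    rw [← hsymm, toEuclideanLin_orderedEigenvectors, inner_smul_left, Complex.conj_ofReal,
      mul_left_comm, ← inner_conj_symm, RCLike.conj_mul]
    push_cast
    rfl
  rw [hterm, Complex.ofReal_re]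
  rcases le_or_gt k i with hk | hk
  · exact mul_le_mul_of_nonneg_right (orderedEigenvalues_monotone hM hk) (by positivity)
  · simp [hx k hk]

end Eigenvalues

section Variational

variable {d : ℕ} {Ω : Set (EuclideanSpace ℝ (Fin d))} {H : L2 Ω →ₗ.[ℂ] L2 Ω} {N : ℕ}

/-- The linear combination of the `f j` with coefficients `x`. -/
noncomputable def combination (f : Fin N → H.domain) : EuclideanSpace ℂ (Fin N) →ₗ[ℂ] H.domain :=
  Fintype.linearCombination ℂ f ∘ₗ (WithLp.linearEquiv 2 ℂ (Fin N → ℂ)).toLinearMap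

theorem coe_combination (f : Fin N → H.domain) (x : EuclideanSpace ℂ (Fin N)) :
    (combination f x : L2 Ω) = ∑ j, x j • (f j : L2 Ω) := by
  simp [combination, Fintype.linearCombination_apply]

/-- Together with `inner_combination_apply`, this identifies Rayleigh quotients on `ℂᴺ` with those
of `H` on the span of the `f j`. -/
theorem sq_norm_combination {f : Fin N → H.domain} (hf : Orthonormal ℂ fun j => (f j : L2 Ω))
    (x : EuclideanSpace ℂ (Fin N)) : ‖(combination f x : L2 Ω)‖ ^ 2 = ‖x‖ ^ 2 := by
  rw [coe_combination, ← inner_self_eq_norm_sq (𝕜 := ℂ), ← inner_self_eq_norm_sq (𝕜 := ℂ),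
    hf.inner_sum, PiLp.inner_apply]
  simp only [RCLike.inner_apply, mul_comm]

theorem inner_combination_apply (f : Fin N → H.domain) (x : EuclideanSpace ℂ (Fin N)) :
    ⟪(combination f x : L2 Ω), H (combination f x)⟫_ℂ =
      ⟪x, Matrix.toEuclideanLin (energyMatrix H f) x⟫_ℂ := by
  have hHu : H (combination f x) = ∑ k, x k • H (f k) := by
    simp [combination, Fintype.linearCombination_apply, ← LinearPMap.toFun_eq_coe, map_sum]
  rw [hHu, coe_combination, sum_inner]
  simp only [inner_smul_left, inner_sum, inner_smul_right, PiLp.inner_apply,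
    Matrix.toLpLin_apply, Matrix.mulVec, dotProduct, energyMatrix, Matrix.of_apply,
    RCLike.inner_apply, Finset.sum_mul]
  refine Finset.sum_congr rfl fun j _ => Finset.sum_congr rfl fun k _ => by ring

/-- The Ritz values of an orthonormal family bound the eigenvalues from above. -/
theorem le_orderedEigenvalues_energyMatrix (hH : H.IsFormalAdjoint H) {φ : ℕ → H.domain}
    {lam : ℕ → ℝ} (hφ : IsOrderedEigenbasis H φ lam) {f : Fin N → H.domain}
    (hf : Orthonormal ℂ fun j => (f j : L2 Ω)) (i : Fin N) :
    lam i ≤ orderedEigenvalues (energyMatrix_isHermitian hH f) i := by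
  set hM := energyMatrix_isHermitian hH f
  let b : HilbertBasis ℕ ℂ (L2 Ω) := HilbertBasis.mk hφ.orthonormal hφ.complete.ge
  have hb : ∀ k, b k = φ k := fun k => congrFun (HilbertBasis.coe_mk _ _) k
  -- One condition for each `k ≠ i`: orthogonality to `φ k` if `k < i`, to the `k`-th matrix
  -- eigenvector if `k > i`. These `N - 1` conditions on `N` coefficients have a nonzero solution,
  -- whose Rayleigh quotient lies between `lam i` and the `i`-th Ritz value.
  let T : EuclideanSpace ℂ (Fin N) →ₗ[ℂ] ({k : Fin N // k ≠ i} → ℂ) :=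
    LinearMap.pi fun k => if k.1 < i
      then (innerSL ℂ (φ k.1 : L2 Ω)).toLinearMap ∘ₗ H.domain.subtype ∘ₗ combination f
      else (innerSL ℂ (orderedEigenvectors hM k.1)).toLinearMap
  have hT : LinearMap.ker T ≠ ⊥ := by
    refine LinearMap.ker_ne_bot_of_finrank_lt ?_
    have := i.pos
    simp [Fintype.card_subtype_compl]
    omega
  obtain ⟨x, hxT, hx0⟩ := (Submodule.ne_bot_iff _).mp hT
  have hT0 : ∀ k (hk : k ≠ i), T x ⟨k, hk⟩ = 0 := fun k hk =>
    congrFun (LinearMap.mem_ker.mp hxT) ⟨k, hk⟩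
  have hlow : ∀ k < (i : ℕ), ⟪(φ k : L2 Ω), (combination f x : L2 Ω)⟫_ℂ = 0 := fun k hk => by
    have hki : (⟨k, hk.trans i.2⟩ : Fin N) < i := hk
    simpa [T, hki] using hT0 _ hki.ne
  have hhigh : ∀ k, i < k → ⟪orderedEigenvectors hM k, x⟫_ℂ = 0 := fun k hk => by
    simpa [T, hk.not_gt] using hT0 k hk.ne'
  have hle := (mul_sq_norm_le_re_inner_apply b hH hb hφ.eigen hφ.mono _ hlow).trans_eq
    (congrArg Complex.re (inner_combination_apply f x))
  rw [sq_norm_combination hf] at hle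
  exact le_of_mul_le_mul_right (hle.trans (re_inner_toEuclideanLin_le hM hhigh))
    (by positivity)

/-- The Ritz values of a regularized minimizer exceed the eigenvalues by `O(1 / μ)`. -/
theorem orderedEigenvalues_sub_le (hH : H.IsFormalAdjoint H) {φ : ℕ → H.domain}
    {lam : ℕ → ℝ} (hφ : IsOrderedEigenbasis H φ lam) {J : L2 Ω → ℝ} {C : ℝ}
    (hJ : ∀ g, 0 ≤ J g ∧ J g ≤ C * ‖g‖) {μ : ℝ} (hμ : 0 < μ) {f : Fin N → H.domain}
    (hf : IsRegMinimizer H J μ f) (i : Fin N) :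
    orderedEigenvalues (energyMatrix_isHermitian hH f) i - lam i ≤ N * C / μ := by
  set ν := orderedEigenvalues (energyMatrix_isHermitian hH f) with hν
  have hlower : ∑ j, ν j ≤ regEnergy H J μ f := by
    rw [hν, sum_orderedEigenvalues, Matrix.trace, Complex.re_sum]
    refine Finset.sum_le_sum fun j _ => ?_
    have : 0 ≤ 1 / μ * J (f j) := mul_nonneg (by positivity) (hJ _).1
    simpa [energyMatrix] using this
  have hortho : Orthonormal ℂ fun j : Fin N => (φ j : L2 Ω) :=
    hφ.orthonormal.comp _ Fin.val_injective
  have hupper : regEnergy H J μ (fun j : Fin N => φ j) ≤ ∑ j : Fin N, (C / μ + lam j) := by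
    refine Finset.sum_le_sum fun j _ => add_le_add ?_ (le_of_eq ?_)
    · rw [one_div, inv_mul_eq_div]
      have := (hJ (φ j)).2
      rw [hφ.orthonormal.1, mul_one] at this
      gcongr
    · rw [hφ.eigen, inner_smul_right, inner_self_eq_norm_sq_to_K, hφ.orthonormal.1]
      simp
  have hsum : ∑ j, (ν j - lam j) ≤ N * C / μ := by
    have := hlower.trans ((hf.le _ hortho).trans hupper)
    rw [Finset.sum_add_distrib, Finset.sum_const, Finset.card_univ, Fintype.card_fin,
      nsmul_eq_mul, ← mul_div_assoc] at this
    rw [Finset.sum_sub_distrib]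
    linarith
  exact (Finset.single_le_sum (f := fun j => ν j - lam j) (fun j _ => sub_nonneg.mpr
    (le_orderedEigenvalues_energyMatrix hH hφ hf.orthonormal j)) (Finset.mem_univ i)).trans hsum

theorem exists_forall_abs_orderedEigenvalues_sub_lt (hH : H.IsFormalAdjoint H)
    {φ : ℕ → H.domain} {lam : ℕ → ℝ} (hφ : IsOrderedEigenbasis H φ lam) {J : L2 Ω → ℝ}
    (hJ : IsNonnegBounded J) {ε : ℝ} (hε : 0 < ε) :
    ∃ μ₀ : ℝ, 0 < μ₀ ∧ ∀ μ : ℝ, μ₀ < μ → ∀ f : Fin N → H.domain, IsRegMinimizer H J μ f →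
      ∀ i : Fin N, |orderedEigenvalues (energyMatrix_isHermitian hH f) i - lam i| < ε := by
  obtain ⟨C, hC⟩ := hJ
  -- The `1` is there because `N * C / ε` need not be positive.
  refine ⟨max 1 (N * C / ε), by positivity, fun μ hμ f hf i => ?_⟩
  obtain ⟨hμ1, hμC⟩ := max_lt_iff.mp hμ
  have hμ0 : 0 < μ := one_pos.trans hμ1
  rw [abs_of_nonneg (sub_nonneg.mpr
    (le_orderedEigenvalues_energyMatrix hH hφ hf.orthonormal i))]
  refine (orderedEigenvalues_sub_le hH hφ hC hμ0 hf i).trans_lt ?_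
  rwa [div_lt_comm₀ hμ0 hε]

end Variational

/-- On a bounded set the `L¹` norm is dominated by the `L²` norm. -/
theorem isNonnegBounded_l1Norm {d : ℕ} {Ω : Set (EuclideanSpace ℝ (Fin d))}
    (hΩ : Bornology.IsBounded Ω) : IsNonnegBounded (l1Norm (Ω := Ω)) := by
  have : IsFiniteMeasure ((volume : Measure (EuclideanSpace ℝ (Fin d))).restrict Ω) :=
    isFiniteMeasure_restrict.mpr hΩ.measure_lt_top.ne
  set m := (volume : Measure (EuclideanSpace ℝ (Fin d))).restrict Ω
  -- The Cauchy–Schwarz constant `|Ω| ^ (1 / 2)`, with the exponent written as `1 / p - 1 / q` for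
  -- `p = 1`, `q = 2`.
  refine ⟨(m Set.univ ^ (1 / (1 : ENNReal).toReal - 1 / (2 : ENNReal).toReal)).toReal,
    fun g => ⟨integral_nonneg fun x => norm_nonneg _, ?_⟩⟩
  have hg := eLpNorm_le_eLpNorm_mul_rpow_measure_univ (μ := m) (p := 1) (q := 2)
    (by norm_num) (Lp.aestronglyMeasurable g)
  rw [l1Norm, integral_norm_eq_lintegral_enorm (Lp.aestronglyMeasurable g),
    ← eLpNorm_one_eq_lintegral_enorm, Lp.norm_def, mul_comm, ← ENNReal.toReal_mul]
  refine ENNReal.toReal_mono (ENNReal.mul_ne_top (Lp.eLpNorm_ne_top g) ?_) hg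
  exact ENNReal.rpow_ne_top_of_nonneg (by norm_num) (measure_ne_top _ _)

end CompressedModes

theorem theorem2 {d : ℕ} (Ω : Set (EuclideanSpace ℝ (Fin d))) (hΩ : IsOpen Ω)
    (hΩb : Bornology.IsBounded Ω) (V : EuclideanSpace ℝ (Fin d) → ℝ)
    (H : CompressedModes.L2 Ω →ₗ.[ℂ] CompressedModes.L2 Ω)
    (hH : CompressedModes.IsHamiltonian Ω V H)
    (φ : ℕ → H.domain) (lam : ℕ → ℝ) (hφ : CompressedModes.IsOrderedEigenbasis H φ lam)
    (N : ℕ) (hN : 1 ≤ N) (hgap : lam (N - 1) < lam N) :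
    -- any nonnegative bounded regularizer
    (∀ J : CompressedModes.L2 Ω → ℝ, CompressedModes.IsNonnegBounded J →
      ∀ ε : ℝ, 0 < ε → ∃ μ₀ : ℝ, 0 < μ₀ ∧ ∀ μ : ℝ, μ₀ < μ → ∀ f : Fin N → H.domain,
        CompressedModes.IsRegMinimizer H J μ f →
        ∀ i : Fin N, |CompressedModes.orderedEigenvalues
          (CompressedModes.energyMatrix_isHermitian hH.symmetric f) i - lam i| < ε) ∧
    -- in particular the `L¹` norm, that is, compressed modes
    (∀ ε : ℝ, 0 < ε → ∃ μ₀ : ℝ, 0 < μ₀ ∧ ∀ μ : ℝ, μ₀ < μ → ∀ ψ : Fin N → H.domain,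
      CompressedModes.IsRegMinimizer H CompressedModes.l1Norm μ ψ →
      ∀ i : Fin N, |CompressedModes.orderedEigenvalues
        (CompressedModes.energyMatrix_isHermitian hH.symmetric ψ) i - lam i| < ε) := by
  exact
    ⟨fun _ hJ _ hε =>
      CompressedModes.exists_forall_abs_orderedEigenvalues_sub_lt hH.symmetric hφ hJ hε,
    fun _ hε => CompressedModes.exists_forall_abs_orderedEigenvalues_sub_lt hH.symmetric hφ
      (CompressedModes.isNonnegBounded_l1Norm hΩb) hε⟩
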